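/- Consider bounded integer linear systems $(F^B)$: $Ax=b,\ 0\le x\le u,\ x\in\mathbb{Z}^n$, where $m,n\ge 0$, $A\in\mathbb{Z}^{m\times n}$, $b\in\mathbb{Z}^m$ and $u\in\mathbb{Z}^n$. A matrix $T\in\mathbb{Z}^{k\times m}$ is called a strong aggregation matrix of size $k$ for $(F^B)$ if the aggregated system $TAx=Tb,\ 0\le x\le u,\ x\in\mathbb{Z}^n$ has exactly the same solutions as $(F^B)$. Then a strong aggregation matrix of size one can be built in polynomial time: there are a Turing machine and a polynomial $p$ such that, for every input $(A,b,u)$ (with all integers written in binary), the machine halts after at most $p(\ell)$ steps, where $\ell$ is the length of the encoding of $(A,b,u)$, and outputs (in binary) a matrix $T\in\mathbb{Z}^{1\times m}$ that is a strong aggregation matrix for $(F^B)$. -/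

import Mathlib

/-- A bounded integer linear feasibility problem `A x = b`, `0 ≤ x ≤ u`, `x ∈ ℤⁿ`, with integer
data: `m` equations in `n` variables. -/
structure BoundedSystem where
  /-- the number of equations -/
  m : ℕ
  /-- the number of variables -/
  n : ℕ
  /-- the matrix of coefficients -/
  A : Matrix (Fin m) (Fin n) ℤ
  /-- the right-hand side -/
  b : Fin m → ℤ
  /-- the upper bounds of the variables -/
  u : Fin n → ℤ

namespace BoundedSystem

/-- The set of all integer solutions of the system. -/
def solutions (S : BoundedSystem) : Set (Fin S.n → ℤ) :=
  {x | S.A.mulVec x = S.b ∧ ∀ j, 0 ≤ x j ∧ x j ≤ S.u j}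

/-- The aggregated system `T A x = T b`, `0 ≤ x ≤ u`, `x ∈ ℤⁿ`, of size `k`. -/
def aggregate (S : BoundedSystem) {k : ℕ} (T : Matrix (Fin k) (Fin S.m) ℤ) : BoundedSystem where
  m := k
  n := S.n
  A := T * S.A
  b := T.mulVec S.b
  u := S.u

/-- `T` is a strong aggregation matrix: the system and its aggregated system have the same
solutions. -/
def IsStrongAggregation (S : BoundedSystem) {k : ℕ} (T : Matrix (Fin k) (Fin S.m) ℤ) : Prop :=
  (S.aggregate T).solutions = S.solutions

end BoundedSystem

/-- The finite alphabet in which systems and matrices are written. -/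
inductive InputSymbol
  | zero
  | one
  | minus
  | comma
  | semicolon
  | bar
  deriving DecidableEq

instance instFintypeInputSymbol : Fintype InputSymbol where
  elems := {InputSymbol.zero, InputSymbol.one, InputSymbol.minus, InputSymbol.comma,
    InputSymbol.semicolon, InputSymbol.bar}
  complete := by intro x; cases x <;> simp

/-- A bit as a symbol. -/
def bitSymbol (c : Bool) : InputSymbol := if c then InputSymbol.one else InputSymbol.zero

/-- An integer in binary: a minus sign if it is negative, then the bits of its absolute value,
the least significant bit first. -/
def encodeInt (z : ℤ) : List InputSymbol :=
  (if z < 0 then [InputSymbol.minus] else []) ++ z.natAbs.bits.map bitSymbol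

/-- An integer vector: its entries in order, each one followed by a comma. -/
def encodeVector {k : ℕ} (v : Fin k → ℤ) : List InputSymbol :=
  (List.ofFn v).flatMap fun z => encodeInt z ++ [InputSymbol.comma]

/-- An integer matrix: its rows in order, each one followed by a semicolon. -/
def encodeMatrix {k l : ℕ} (M : Matrix (Fin k) (Fin l) ℤ) : List InputSymbol :=
  (List.ofFn fun i => M i).flatMap fun v => encodeVector v ++ [InputSymbol.semicolon]

/-- A bounded system `(A, b, u)`: the matrix and the two vectors, separated by bars. -/
def encodeSystem (S : BoundedSystem) : List InputSymbol :=
  encodeMatrix S.A ++ [InputSymbol.bar] ++ encodeVector S.b ++ [InputSymbol.bar] ++ encodeVector S.u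

/-- `f` is computed by a multi-stack Turing machine, with all its stack alphabets finite, in a
number of steps that is at most a fixed polynomial in the length of the encoded input. -/
def PolyTimeComputable {α β Γ₀ Γ₁ : Type} (enc : α → List Γ₀) (out : β → List Γ₁) (f : α → β) :
    Prop :=
  ∃ M : Turing.TM2ComputableInPolyTime enc out f, ∀ k, Finite (M.tm.Γ k)

/-! Let ℓ be the length of the encoded system and B = 2 ^ ℓ. Every integer x with 0 ≤ x ≤ u has
residuals A x - b of absolute value below B (`BoundedSystem.abs_residual_lt`), because ℓ counts the
bits of all entries of A, b and u. The row (B ^ (m - 1), …, B, 1) turns the residual vector into a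
number with these signed digits in base B, and such a number vanishes only if all its digits do
(`eq_zero_of_sum_mul_pow_eq_zero`).

Computing the row takes no real arithmetic: B ^ k in binary is kℓ zeros and a one, and m is the
number of semicolons in the input. A stack machine with unary counters, none above ℓ ^ 2, therefore
suffices and runs in cubic time (`exists_reachesIn_halt`). -/

open Turing

namespace BoundedSystem

/-- The row `(B ^ (m - 1), …, B, 1)` with `B = 2 ^ ℓ`, where `ℓ` is the length of the encoded
system. -/
def powerRow (S : BoundedSystem) : Matrix (Fin 1) (Fin S.m) ℤ :=
  fun _ i => 2 ^ ((encodeSystem S).length * (i.rev : ℕ))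

end BoundedSystem

/-! ### Residual bounds and uniqueness of signed digits -/

section Bounds

theorem natAbs_lt_two_pow_length_encodeInt (z : ℤ) : z.natAbs < 2 ^ (encodeInt z).length := by
  refine (Nat.lt_size_self z.natAbs).trans_le (Nat.pow_le_pow_right two_pos ?_)
  simp [encodeInt, Nat.size_eq_bits_len]

theorem length_encodeVector {k : ℕ} (v : Fin k → ℤ) :
    (encodeVector v).length = ∑ j, ((encodeInt (v j)).length + 1) := by
  simp [encodeVector, List.length_flatMap, List.map_ofFn, List.sum_ofFn]

theorem one_add_sum_le_prod_one_add {ι : Type*} (s : Finset ι) (f : ι → ℕ) :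
    1 + ∑ j ∈ s, f j ≤ ∏ j ∈ s, (1 + f j) := by
  classical
  induction s using Finset.induction_on with
  | empty => simp
  | insert a s ha ih =>
    rw [Finset.sum_insert ha, Finset.prod_insert ha]
    nlinarith [Nat.zero_le (f a * ∑ j ∈ s, f j)]

theorem one_add_sum_natAbs_le {k : ℕ} (v : Fin k → ℤ) :
    1 + ∑ j, (v j).natAbs ≤ 2 ^ (encodeVector v).length := by
  calc 1 + ∑ j, (v j).natAbs ≤ ∏ j, (1 + (v j).natAbs) := one_add_sum_le_prod_one_add _ _
    _ ≤ ∏ j, 2 ^ ((encodeInt (v j)).length + 1) := by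
        refine Finset.prod_le_prod' fun j _ => ?_
        have := natAbs_lt_two_pow_length_encodeInt (v j)
        rw [pow_succ]
        omega
    _ = 2 ^ (encodeVector v).length := by
        rw [Finset.prod_pow_eq_pow_sum, length_encodeVector]

theorem length_encodeVector_row_le {k l : ℕ} (M : Matrix (Fin k) (Fin l) ℤ) (i : Fin k) :
    (encodeVector (M i)).length ≤ (encodeMatrix M).length := by
  simp only [encodeMatrix, List.length_flatMap, List.map_ofFn, List.sum_ofFn, Function.comp_apply,
    List.length_append]
  refine (Nat.le_add_right _ _).trans
    (Finset.single_le_sum (f := fun i => (encodeVector (M i)).length + [InputSymbol.semicolon].length)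
      (fun _ _ => Nat.zero_le _) (Finset.mem_univ i))

/-- The residual is at most a * c + b, with a, b, c the sums of absolute values over row i of A,
over b and over u. These terms occur in the expansion of (1 + a)(1 + b)(1 + c), and each factor is
at most 2 to the length of its own part of the encoding. -/
theorem BoundedSystem.abs_residual_lt (S : BoundedSystem) (x : Fin S.n → ℤ)
    (hx : ∀ j, 0 ≤ x j ∧ x j ≤ S.u j) (i : Fin S.m) :
    |S.A.mulVec x i - S.b i| < 2 ^ (encodeSystem S).length := by
  have hsum : (S.A.mulVec x i - S.b i).natAbs ≤
      (∑ j, (S.A i j).natAbs) * (∑ j, (S.u j).natAbs) + ∑ j, (S.b j).natAbs := by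
    refine (Int.natAbs_sub_le _ _).trans (add_le_add ?_ ?_)
    · calc (S.A.mulVec x i).natAbs ≤ ∑ j, (S.A i j * x j).natAbs := by
            simpa [Matrix.mulVec, dotProduct] using Int.natAbs_sum_le Finset.univ fun j => S.A i j * x j
        _ ≤ ∑ j, (S.A i j).natAbs * ∑ j, (S.u j).natAbs := by
            refine Finset.sum_le_sum fun j _ => ?_
            rw [Int.natAbs_mul]
            refine Nat.mul_le_mul_left _ (le_trans ?_ (Finset.single_le_sum
              (f := fun j => (S.u j).natAbs) (fun _ _ => Nat.zero_le _) (Finset.mem_univ j)))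
            have := hx j
            omega
        _ = _ := by rw [Finset.sum_mul]
    · exact Finset.single_le_sum (f := fun j => (S.b j).natAbs) (fun _ _ => Nat.zero_le _)
        (Finset.mem_univ i)
  have hprod : (1 + ∑ j, (S.A i j).natAbs) * (1 + ∑ j, (S.b j).natAbs) *
      (1 + ∑ j, (S.u j).natAbs) ≤ 2 ^ (encodeSystem S).length := by
    refine (Nat.mul_le_mul (Nat.mul_le_mul (one_add_sum_natAbs_le (S.A i))
      (one_add_sum_natAbs_le S.b)) (one_add_sum_natAbs_le S.u)).trans ?_
    rw [← pow_add, ← pow_add]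
    refine Nat.pow_le_pow_right two_pos ?_
    have := length_encodeVector_row_le S.A i
    simp only [encodeSystem, List.length_append]
    omega
  have hlt : (S.A.mulVec x i - S.b i).natAbs < 2 ^ (encodeSystem S).length := by
    refine lt_of_lt_of_le ?_ hprod
    generalize ∑ j, (S.A i j).natAbs = a at *
    generalize ∑ j, (S.b j).natAbs = b at *
    generalize ∑ j, (S.u j).natAbs = c at *
    refine Nat.lt_of_le_of_lt hsum ?_
    have : (1 + a) * (1 + b) * (1 + c) = a * c + b + 1 + (a + c + a * b + b * c + a * b * c) := by
      ring
    omega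
  rw [Int.abs_eq_natAbs]
  exact_mod_cast hlt

/-- Modulo B only the lowest digit survives, so B divides it and it is zero by size; dividing by B
leaves a shorter sum. -/
theorem eq_zero_of_sum_mul_pow_eq_zero {B : ℤ} :
    ∀ {m : ℕ} (r : Fin m → ℤ), (∀ i, |r i| < B) → ∑ i : Fin m, B ^ (i : ℕ) * r i = 0 → ∀ i, r i = 0
  | 0, _, _, _, i => i.elim0
  | m + 1, r, hr, hsum, i => by
    have hB : 0 < B := (abs_nonneg _).trans_lt (hr 0)
    have hsplit : r 0 + B * ∑ i : Fin m, B ^ (i : ℕ) * r i.succ = 0 := by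
      rw [← hsum, Fin.sum_univ_succ, Finset.mul_sum]
      simp [pow_succ', mul_assoc]
    have h0 : r 0 = 0 :=
      Int.eq_zero_of_abs_lt_dvd ⟨-∑ i : Fin m, B ^ (i : ℕ) * r i.succ, by linarith⟩ (hr 0)
    have hrest : ∑ i : Fin m, B ^ (i : ℕ) * r i.succ = 0 := by
      rw [h0, zero_add] at hsplit
      exact (mul_eq_zero.mp hsplit).resolve_left hB.ne'
    refine Fin.cases h0 (fun i => ?_) i
    exact eq_zero_of_sum_mul_pow_eq_zero (fun i : Fin m => r i.succ) (fun i => hr _) hrest i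

theorem BoundedSystem.isStrongAggregation_powerRow (S : BoundedSystem) :
    S.IsStrongAggregation S.powerRow := by
  ext x
  refine and_congr_left fun hx => ?_
  change Fin S.n → ℤ at x
  change (S.powerRow * S.A).mulVec x = S.powerRow.mulVec S.b ↔ S.A.mulVec x = S.b
  rw [← Matrix.mulVec_mulVec]
  refine ⟨fun h => ?_, fun h => by rw [h]⟩
  have h0 : ∑ i, S.powerRow 0 i * (S.A.mulVec x i - S.b i) = 0 := by
    have := congrFun h 0
    simp only [Matrix.mulVec, dotProduct] at this ⊢
    simp only [mul_sub, Finset.sum_sub_distrib]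
    linarith
  -- The row starts with the highest power, the digit lemma with the lowest.
  have hrev : ∑ i : Fin S.m, ((2 : ℤ) ^ (encodeSystem S).length) ^ (i : ℕ) *
      (S.A.mulVec x i.rev - S.b i.rev) = 0 := by
    rw [← h0, ← Equiv.sum_comp Fin.revPerm]
    simp [powerRow, pow_mul]
  funext i
  have := eq_zero_of_sum_mul_pow_eq_zero _ (fun i => S.abs_residual_lt x hx i.rev) hrev i.rev
  rw [Fin.rev_rev] at this
  exact sub_eq_zero.mp this

end Bounds

/-! ### The encoded row of powers -/

section Encoding

theorem Nat.bits_two_pow (e : ℕ) : (2 ^ e).bits = List.replicate e false ++ [true] := by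
  induction e with
  | zero => simp
  | succ e ih =>
    rw [pow_succ', Nat.bit0_bits _ (by positivity), ih]
    rfl

theorem encodeInt_two_pow (e : ℕ) :
    encodeInt (2 ^ e) = List.replicate e InputSymbol.zero ++ [InputSymbol.one] := by
  have h : ((2 : ℤ) ^ e).natAbs = 2 ^ e := by simp [Int.natAbs_pow]
  have h' : ¬ (2 : ℤ) ^ e < 0 := not_lt.mpr (by positivity)
  simp [encodeInt, h, h', Nat.bits_two_pow, bitSymbol]

/-- The list `o` preceded by the encodings of `2 ^ (e + (k - 1) * ℓ), …, 2 ^ (e + ℓ), 2 ^ e`. -/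
def prependPowers (ℓ : ℕ) : ℕ → ℕ → List InputSymbol → List InputSymbol
  | 0, _, o => o
  | k + 1, e, o => prependPowers ℓ k (ℓ + e)
      (List.replicate e InputSymbol.zero ++ InputSymbol.one :: InputSymbol.comma :: o)

/-- A stack grows at its front, so the row is produced from its last entry, with exponents rising by
ℓ. -/
theorem prependPowers_eq (ℓ k e : ℕ) (o : List InputSymbol) :
    prependPowers ℓ k e o = encodeVector (fun i : Fin k => 2 ^ (e + ℓ * (i.rev : ℕ))) ++ o := by
  induction k generalizing e o with
  | zero => simp [prependPowers, encodeVector]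
  | succ k ih =>
    rw [prependPowers, ih]
    have h : ∀ i : Fin k, e + ℓ * (k - (i : ℕ)) = ℓ + e + ℓ * (k - (i + 1)) := by
      intro i
      have : k - (i : ℕ) = k - (i + 1) + 1 := by omega
      rw [this]
      ring
    rw [encodeVector, encodeVector, List.ofFn_succ']
    simp [encodeInt_two_pow, h, Fin.val_rev]

theorem encodeMatrix_powerRow (S : BoundedSystem) : encodeMatrix S.powerRow =
    prependPowers (encodeSystem S).length S.m 0 [InputSymbol.semicolon] := by
  have h : S.powerRow 0 = fun i => 2 ^ (0 + (encodeSystem S).length * (i.rev : ℕ)) := by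
    funext i
    rw [zero_add]
    rfl
  simp [prependPowers_eq, encodeMatrix, h]

theorem semicolon_notMem_encodeVector {k : ℕ} (v : Fin k → ℤ) :
    InputSymbol.semicolon ∉ encodeVector v := by
  simp only [encodeVector, encodeInt, List.mem_flatMap, List.mem_append, List.mem_map, not_exists]
  rintro z ⟨-, (h | ⟨c, -, h⟩) | h⟩
  · split_ifs at h <;> simp at h
  · cases c <;> simp [bitSymbol] at h
  · simp at h

/-- This is how the machine finds m; it works even for n = 0, where each row is a lone semicolon. -/
theorem count_semicolon_encodeSystem (S : BoundedSystem) :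
    (encodeSystem S).count InputSymbol.semicolon = S.m := by
  simp [encodeSystem, encodeMatrix, List.count_flatMap, Function.comp_def,
    List.count_eq_zero_of_not_mem (semicolon_notMem_encodeVector _)]

end Encoding

/-! ### The aggregation machine -/

/-- The stacks of the aggregation machine. -/
inductive AggStack
  | input
  | pending
  | size
  | exponent
  | output
  deriving DecidableEq

instance : Fintype AggStack where
  elems := {AggStack.input, AggStack.pending, AggStack.size, AggStack.exponent, AggStack.output}
  complete := by intro x; cases x <;> simp

/-- The labels of the aggregation machine. -/
inductive AggLabel
  | start
  | load
  | scan
  | emit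
  | restoreExponent
  | grow
  | restoreSize
  | clearExponent
  | clearSize
  deriving DecidableEq

instance : Fintype AggLabel where
  elems := {AggLabel.start, AggLabel.load, AggLabel.scan, AggLabel.emit, AggLabel.restoreExponent,
    AggLabel.grow, AggLabel.restoreSize, AggLabel.clearExponent, AggLabel.clearSize}
  complete := by intro x; cases x <;> simp

/-- The statements of the aggregation machine; its internal state is the symbol read last. -/
abbrev AggStmt : Type := TM2.Stmt (fun _ : AggStack => InputSymbol) AggLabel (Option InputSymbol)

namespace AggStmt

/-- Pop a symbol from stack `k`; do `q` if there was one and `q'` if the stack was empty. -/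
def popThen (k : AggStack) (q q' : AggStmt) : AggStmt :=
  .pop k (fun _ s => s) (.branch Option.isSome q q')

/-- Push the fixed symbol `c` on stack `k`. -/
def pushSymbol (k : AggStack) (c : InputSymbol) (q : AggStmt) : AggStmt := .push k (fun _ => c) q

/-- Jump to the label `l`. -/
def jump (l : AggLabel) : AggStmt := .goto fun _ => l

end AggStmt

open AggStmt in
/-- The program of the aggregation machine. The input is moved to `pending` and its length is
stored in unary in `size`. For each semicolon of the input, one entry of the row is written:
the power of two whose exponent is stored in unary in `exponent`, which then grows by `size`. -/
def aggProgram : AggLabel → AggStmt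
  | .start => pushSymbol .output .semicolon (jump .load)
  | .load => popThen .input
      -- The default `.zero` is never used: this branch follows a successful pop.
      (.push .pending (fun s => s.getD .zero) (pushSymbol .size .zero (jump .load))) (jump .scan)
  | .scan => popThen .pending
      (.branch (fun s => decide (s = some .semicolon))
        -- Pushing reverses the order: the leading one goes below the zeros, since bits are written
        -- least significant first.
        (pushSymbol .output .comma (pushSymbol .output .one (jump .emit))) (jump .scan))
      (jump .clearExponent)
  | .emit => popThen .exponent
      (pushSymbol .input .zero (pushSymbol .output .zero (jump .emit))) (jump .restoreExponent)
  | .restoreExponent => popThen .input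
      (pushSymbol .exponent .zero (jump .restoreExponent)) (jump .grow)
  | .grow => popThen .size
      (pushSymbol .input .zero (pushSymbol .exponent .zero (jump .grow))) (jump .restoreSize)
  | .restoreSize => popThen .input (pushSymbol .size .zero (jump .restoreSize)) (jump .scan)
  | .clearExponent => popThen .exponent (jump .clearExponent) (jump .clearSize)
  | .clearSize => popThen .size (jump .clearSize) .halt

/-- The machine that writes the aggregation row of a system. -/
def aggMachine : FinTM2 where
  K := AggStack
  k₀ := .input
  k₁ := .output
  Γ _ := InputSymbol
  Λ := AggLabel
  main := .start
  σ := Option InputSymbol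
  initialState := none
  Γk₀Fin := instFintypeInputSymbol
  m := aggProgram

/-! ### Runs of the machine and their lengths -/

namespace AggMachine

/-- The contents of all stacks. -/
def contents (i p s e o : List InputSymbol) : AggStack → List InputSymbol
  | .input => i
  | .pending => p
  | .size => s
  | .exponent => e
  | .output => o

section Update

variable (i p s e o x : List InputSymbol)

@[simp] theorem update_input :
    Function.update (contents i p s e o) .input x = contents x p s e o := by
  funext k; cases k <;> rfl

@[simp] theorem update_pending :
    Function.update (contents i p s e o) .pending x = contents i x s e o := by
  funext k; cases k <;> rfl

@[simp] theorem update_size :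
    Function.update (contents i p s e o) .size x = contents i p x e o := by
  funext k; cases k <;> rfl

@[simp] theorem update_exponent :
    Function.update (contents i p s e o) .exponent x = contents i p s x o := by
  funext k; cases k <;> rfl

@[simp] theorem update_output :
    Function.update (contents i p s e o) .output x = contents i p s e x := by
  funext k; cases k <;> rfl

end Update

/-- The configurations of the aggregation machine. -/
abbrev Config : Type :=
  TM2.Cfg (fun _ : AggStack => InputSymbol) AggLabel (Option InputSymbol)

/-- `ReachesIn n c d` says that `n` steps lead from `c` to `d`. -/
def ReachesIn (n : ℕ) (c d : Config) : Prop :=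
  (flip bind (TM2.step aggProgram))^[n] (some c) = some d

theorem ReachesIn.refl (c : Config) : ReachesIn 0 c c := rfl

theorem ReachesIn.trans {a b : ℕ} {c d e : Config} (h : ReachesIn a c d) (h' : ReachesIn b d e) :
    ReachesIn (a + b) c e := by
  rw [ReachesIn, add_comm, Function.iterate_add_apply, h, h']

theorem ReachesIn.head {n : ℕ} {c d e : Config} (h : TM2.step aggProgram c = some d)
    (h' : ReachesIn n d e) : ReachesIn (n + 1) c e := by
  rw [ReachesIn, Function.iterate_succ_apply]
  exact (congrArg _ h).trans h'

/-- `n` copies of the symbol for zero. -/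
abbrev zeros (n : ℕ) : List InputSymbol := List.replicate n InputSymbol.zero

theorem zeros_append_cons (n : ℕ) (o : List InputSymbol) :
    zeros n ++ InputSymbol.zero :: o = zeros (n + 1) ++ o := by
  rw [List.append_cons, ← List.replicate_succ']

/-- The reversal of the input is harmless, as only its semicolons are counted later. -/
theorem reachesIn_load (l p : List InputSymbol) (n : ℕ) (v : Option InputSymbol)
    (e o : List InputSymbol) :
    ReachesIn (l.length + 1) ⟨some .load, v, contents l p (zeros n) e o⟩
      ⟨some .scan, none, contents [] (l.reverse ++ p) (zeros (l.length + n)) e o⟩ := by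
  induction l generalizing p n v with
  | nil =>
    refine .head (d := ⟨some .scan, none, contents [] p (zeros n) e o⟩) ?_ (by simpa using .refl _)
    simp [aggProgram, AggStmt.popThen, AggStmt.jump, contents]
  | cons c l ih =>
    refine .head (d := ⟨some .load, some c, contents l (c :: p) (zeros (n + 1)) e o⟩) ?_ ?_
    · simp [aggProgram, AggStmt.popThen, AggStmt.jump, AggStmt.pushSymbol, contents,
        List.replicate_succ]
    · simpa [add_comm, add_left_comm] using ih (c :: p) (n + 1) (some c)

/-- The emptied input stack serves as scratch space, so that the exponent can be restored after it
is consumed. -/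
theorem reachesIn_emit (a b : ℕ) (v : Option InputSymbol) (p s o : List InputSymbol) :
    ReachesIn (a + 1) ⟨some .emit, v, contents (zeros b) p s (zeros a) o⟩
      ⟨some .restoreExponent, none, contents (zeros (a + b)) p s [] (zeros a ++ o)⟩ := by
  induction a generalizing b v o with
  | zero =>
    refine .head (d := ⟨some .restoreExponent, none, contents (zeros b) p s [] o⟩) ?_
      (by simpa using .refl _)
    simp [aggProgram, AggStmt.popThen, AggStmt.jump, contents]
  | succ a ih =>
    refine .head (d := ⟨some .emit, some .zero, contents (zeros (b + 1)) p s (zeros a)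
      (.zero :: o)⟩) ?_ ?_
    · simp [aggProgram, AggStmt.popThen, AggStmt.jump, AggStmt.pushSymbol, contents,
        List.replicate_succ]
    · simpa only [zeros_append_cons, add_comm, add_left_comm] using ih (b + 1) (some .zero) (.zero :: o)

theorem reachesIn_restoreExponent (a b : ℕ) (v : Option InputSymbol) (p s o : List InputSymbol) :
    ReachesIn (a + 1) ⟨some .restoreExponent, v, contents (zeros a) p s (zeros b) o⟩
      ⟨some .grow, none, contents [] p s (zeros (a + b)) o⟩ := by
  induction a generalizing b v with
  | zero =>
    refine .head (d := ⟨some .grow, none, contents [] p s (zeros b) o⟩) ?_ (by simpa using .refl _)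
    simp [aggProgram, AggStmt.popThen, AggStmt.jump, contents]
  | succ a ih =>
    refine .head (d := ⟨some .restoreExponent, some .zero, contents (zeros a) p s (zeros (b + 1)) o⟩)
      ?_ ?_
    · simp [aggProgram, AggStmt.popThen, AggStmt.jump, AggStmt.pushSymbol, contents,
        List.replicate_succ]
    · simpa only [add_comm, add_left_comm] using ih (b + 1) (some .zero)

theorem reachesIn_grow (a b c : ℕ) (v : Option InputSymbol) (p o : List InputSymbol) :
    ReachesIn (a + 1) ⟨some .grow, v, contents (zeros b) p (zeros a) (zeros c) o⟩
      ⟨some .restoreSize, none, contents (zeros (a + b)) p [] (zeros (a + c)) o⟩ := by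
  induction a generalizing b c v with
  | zero =>
    refine .head (d := ⟨some .restoreSize, none, contents (zeros b) p [] (zeros c) o⟩) ?_
      (by simpa using .refl _)
    simp [aggProgram, AggStmt.popThen, AggStmt.jump, contents]
  | succ a ih =>
    refine .head (d := ⟨some .grow, some .zero,
      contents (zeros (b + 1)) p (zeros a) (zeros (c + 1)) o⟩) ?_ ?_
    · simp [aggProgram, AggStmt.popThen, AggStmt.jump, AggStmt.pushSymbol, contents,
        List.replicate_succ]
    · simpa only [add_comm, add_left_comm] using ih (b + 1) (c + 1) (some .zero)

theorem reachesIn_restoreSize (a b : ℕ) (v : Option InputSymbol) (p e o : List InputSymbol) :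
    ReachesIn (a + 1) ⟨some .restoreSize, v, contents (zeros a) p (zeros b) e o⟩
      ⟨some .scan, none, contents [] p (zeros (a + b)) e o⟩ := by
  induction a generalizing b v with
  | zero =>
    refine .head (d := ⟨some .scan, none, contents [] p (zeros b) e o⟩) ?_ (by simpa using .refl _)
    simp [aggProgram, AggStmt.popThen, AggStmt.jump, contents]
  | succ a ih =>
    refine .head (d := ⟨some .restoreSize, some .zero, contents (zeros a) p (zeros (b + 1)) e o⟩)
      ?_ ?_
    · simp [aggProgram, AggStmt.popThen, AggStmt.jump, AggStmt.pushSymbol, contents,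
        List.replicate_succ]
    · simpa only [add_comm, add_left_comm] using ih (b + 1) (some .zero)

theorem reachesIn_clearExponent (a : ℕ) (v : Option InputSymbol) (i p s o : List InputSymbol) :
    ReachesIn (a + 1) ⟨some .clearExponent, v, contents i p s (zeros a) o⟩
      ⟨some .clearSize, none, contents i p s [] o⟩ := by
  induction a generalizing v with
  | zero =>
    refine .head ?_ (.refl _)
    simp [aggProgram, AggStmt.popThen, AggStmt.jump, contents]
  | succ a ih =>
    refine .head ?_ (ih (some .zero))
    simp [aggProgram, AggStmt.popThen, AggStmt.jump, contents, List.replicate_succ]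

theorem reachesIn_clearSize (a : ℕ) (v : Option InputSymbol) (i p e o : List InputSymbol) :
    ReachesIn (a + 1) ⟨some .clearSize, v, contents i p (zeros a) e o⟩
      ⟨none, none, contents i p [] e o⟩ := by
  induction a generalizing v with
  | zero =>
    refine .head ?_ (.refl _)
    simp [aggProgram, AggStmt.popThen, contents]
  | succ a ih =>
    refine .head ?_ (ih (some .zero))
    simp [aggProgram, AggStmt.popThen, AggStmt.jump, contents, List.replicate_succ]

theorem reachesIn_entry (ℓ e : ℕ) (v : Option InputSymbol) (l o : List InputSymbol) :
    ReachesIn (2 * e + 2 * ℓ + 5)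
      ⟨some .scan, v, contents [] (.semicolon :: l) (zeros ℓ) (zeros e) o⟩
      ⟨some .scan, none, contents [] l (zeros ℓ) (zeros (ℓ + e))
        (zeros e ++ .one :: .comma :: o)⟩ := by
  have h : ReachesIn _ ⟨some .emit, some .semicolon,
      contents [] l (zeros ℓ) (zeros e) (.one :: .comma :: o)⟩ _ :=
    (((reachesIn_emit e 0 _ l _ _).trans (reachesIn_restoreExponent e 0 _ l _ _)).trans
      (reachesIn_grow ℓ 0 e _ l _)).trans (reachesIn_restoreSize ℓ 0 _ l _ _)
  have h' : ReachesIn _ ⟨some .scan, v, contents [] (.semicolon :: l) (zeros ℓ) (zeros e) o⟩ _ :=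
    .head (by simp [aggProgram, AggStmt.popThen, AggStmt.jump, AggStmt.pushSymbol, contents]) h
  have hn : 2 * e + 2 * ℓ + 5 = e + 1 + (e + 1) + (ℓ + 1) + (ℓ + 1) + 1 := by ring
  rw [hn]
  exact h'

/-- Each symbol raises the exponent by at most ℓ, so it never exceeds e + l.length * ℓ; this bounds
the cost of every entry uniformly. -/
theorem exists_reachesIn_scan (ℓ e : ℕ) (v : Option InputSymbol) (l o : List InputSymbol) :
    ∃ n ≤ l.length * (2 * (e + l.length * ℓ) + 2 * ℓ + 5) + 1,
      ∃ e' ≤ e + l.length * ℓ,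
        ReachesIn n ⟨some .scan, v, contents [] l (zeros ℓ) (zeros e) o⟩
          ⟨some .clearExponent, none, contents [] [] (zeros ℓ) (zeros e')
            (prependPowers ℓ (l.count .semicolon) e o)⟩ := by
  induction l generalizing e v o with
  | nil =>
    refine ⟨1, by simp, e, by simp, .head ?_ (.refl _)⟩
    simp [aggProgram, AggStmt.popThen, AggStmt.jump, contents, prependPowers]
  | cons c l ih =>
    by_cases hc : c = .semicolon
    · subst hc
      obtain ⟨n, hn, e', he', h⟩ := ih (ℓ + e) none (zeros e ++ .one :: .comma :: o)
      refine ⟨2 * e + 2 * ℓ + 5 + n, ?_, e', ?_, ?_⟩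
      · simp only [List.length_cons]
        nlinarith [Nat.zero_le (l.length * ℓ)]
      · simp only [List.length_cons]
        linarith
      · rw [List.count_cons_self, prependPowers]
        exact (reachesIn_entry ℓ e v l o).trans h
    · obtain ⟨n, hn, e', he', h⟩ := ih e (some c) o
      refine ⟨n + 1, ?_, e', ?_, ?_⟩
      · simp only [List.length_cons]
        nlinarith [Nat.zero_le (l.length * ℓ)]
      · simp only [List.length_cons]
        linarith
      · rw [List.count_cons_of_ne hc]
        refine .head ?_ h
        simp [aggProgram, AggStmt.popThen, AggStmt.jump, contents, hc]

theorem exists_reachesIn_halt (l : List InputSymbol) :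
    ∃ n ≤ 2 * l.length ^ 3 + 3 * l.length ^ 2 + 7 * l.length + 5,
      ReachesIn n ⟨some .start, none, contents l [] [] [] []⟩
        ⟨none, none, contents [] [] [] []
          (prependPowers l.length (l.count .semicolon) 0 [.semicolon])⟩ := by
  obtain ⟨n, hn, e, he, h⟩ :=
    exists_reachesIn_scan l.length 0 none l.reverse [InputSymbol.semicolon]
  rw [List.length_reverse] at hn he
  rw [List.count_reverse] at h
  have hload : ReachesIn _ _ _ := reachesIn_load l [] 0 none [] [InputSymbol.semicolon]
  rw [List.append_nil, add_zero] at hload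
  -- The summands count loading, scanning, the two clearing loops and the initial step. Clearing is
  -- needed because a halting configuration must have only the output stack nonempty.
  refine ⟨l.length + 1 + n + (e + 1) + (l.length + 1) + 1, ?_, .head ?_ (((hload.trans h).trans
    (reachesIn_clearExponent e none _ _ _ _)).trans (reachesIn_clearSize l.length none _ _ _ _))⟩
  · have : l.length * (2 * (0 + l.length * l.length) + 2 * l.length + 5) + 1 =
      2 * l.length ^ 3 + 2 * l.length ^ 2 + 5 * l.length + 1 := by ring
    have : 0 + l.length * l.length = l.length ^ 2 := by ring
    omega
  · simp [aggProgram, AggStmt.jump, AggStmt.pushSymbol, contents]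

theorem exists_reachesIn_encodeMatrix_powerRow (S : BoundedSystem) :
    ∃ n ≤ 2 * (encodeSystem S).length ^ 3 + 3 * (encodeSystem S).length ^ 2 +
        7 * (encodeSystem S).length + 5,
      ReachesIn n ⟨some .start, none, contents (encodeSystem S) [] [] [] []⟩
        ⟨none, none, contents [] [] [] [] (encodeMatrix S.powerRow)⟩ := by
  have h := exists_reachesIn_halt (encodeSystem S)
  rwa [count_semicolon_encodeSystem, ← encodeMatrix_powerRow] at h

theorem initList_eq (l : List InputSymbol) :
    initList aggMachine l = (⟨some .start, none, contents l [] [] [] []⟩ : Config) := by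
  refine congrArg (TM2.Cfg.mk _ _) (funext fun k => ?_)
  cases k <;> rfl

theorem haltList_eq (l : List InputSymbol) :
    haltList aggMachine l = (⟨none, none, contents [] [] [] [] l⟩ : Config) := by
  refine congrArg (TM2.Cfg.mk _ _) (funext fun k => ?_)
  cases k <;> rfl

end AggMachine

/-! ### Polynomial-time computability -/

open AggMachine in
/-- The aggregation machine computes the row of powers in polynomial time. -/
noncomputable def powerRowComputableInPolyTime :
    TM2ComputableInPolyTime (β := Σ m : ℕ, Matrix (Fin 1) (Fin m) ℤ)
      encodeSystem (fun p => encodeMatrix p.2) (fun S => ⟨S.m, S.powerRow⟩) where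
  tm := aggMachine
  inputAlphabet := Equiv.refl InputSymbol
  outputAlphabet := Equiv.refl InputSymbol
  time := 2 * .X ^ 3 + 3 * .X ^ 2 + 7 * .X + 5
  outputsFun S :=
    { steps := (exists_reachesIn_encodeMatrix_powerRow S).choose
      evals_in_steps := by
        have h := (exists_reachesIn_encodeMatrix_powerRow S).choose_spec.2
        have hin : (encodeSystem S).map (Equiv.refl InputSymbol).invFun = encodeSystem S :=
          List.map_id _
        have hout : (encodeMatrix S.powerRow).map (Equiv.refl InputSymbol).invFun =
          encodeMatrix S.powerRow := List.map_id _
        have hi := (congrArg (initList aggMachine) hin).trans (initList_eq (encodeSystem S))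
        have ho := (congrArg (haltList aggMachine) hout).trans
          (haltList_eq (encodeMatrix S.powerRow))
        exact (congrArg (fun c => (flip bind aggMachine.step)^[_] (some c)) hi).trans
          (Eq.trans h (congrArg some ho.symm))
      steps_le_m := by
        simpa using (exists_reachesIn_encodeMatrix_powerRow S).choose_spec.1 }

theorem mainTheorem5 :
    ∃ T : (S : BoundedSystem) → Matrix (Fin 1) (Fin S.m) ℤ,
      (∀ S : BoundedSystem, S.IsStrongAggregation (T S)) ∧
      PolyTimeComputable (α := BoundedSystem) (β := Σ m : ℕ, Matrix (Fin 1) (Fin m) ℤ)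
        encodeSystem (fun p => encodeMatrix p.2) (fun S => ⟨S.m, T S⟩) :=
  ⟨BoundedSystem.powerRow, BoundedSystem.isStrongAggregation_powerRow,
    powerRowComputableInPolyTime, fun _ => Finite.of_fintype InputSymbol⟩
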